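/- For $s>0$ let $G_s$ denote a Gamma variable with shape $s$ and expectation $1$. For $\alpha,\theta,\beta,\tau,\gamma>0$ the PowerBurr$_5$ distribution with parameter $\Phi=(\alpha,\theta,\beta,\tau,\gamma)$ is the law of $$Z=\beta\{(1+X/\tau)^{\gamma}-1\},\qquad X=G_\theta/G_\alpha,$$ with $G_\theta$ and $G_\alpha$ independent. Let $a,b,c,\sigma>0$ and $\xi\in\mathbb{R}$, and write $\bar F(z)=\Pr(Z>z)$ for $z>0$. The PowerBurr$_5$ family contains the following ten families, the first two exactly and the others as limits in distribution (when several parameters vary, their limits are taken jointly, with no restriction on the relative rates except where one is stated). 1. Burr, $Z=bG_c/G_a$ with $G_c$ and $G_a$ independent: $\alpha=a$, $\theta=c$, $\tau=\gamma=1$, $\beta=b$. 2. Pareto, $\bar F(z)=1/(1+z/b)^a$: $\alpha=a$, $\theta=1$, $\tau=\gamma=1$, $\beta=b/a$. 3. Gamma, $Z=bG_c$: $\alpha\to\infty$, $\theta=c$, $\tau=\gamma=1$, $\beta=b$. 4. Inverse Gamma, $Z=b/G_a$: $\alpha=a$, $\theta\to\infty$, $\tau=\gamma=1$, $\beta=b$.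 5. Log-gamma, $\log(1+Z)=bG_c$: $\alpha\to\infty$, $\theta=c$, $\gamma\to\infty$, $\tau=\gamma/b$, $\beta=1$. 6. Logistic (on the positive half-line), $\bar F(z)=1/(1-a+ae^{z/b})$: $\alpha=\theta=1$, $\tau=a$, $\gamma\to0$, $\beta=b/\gamma$. 7. Log-logistic, $\bar F(z)=1/\{1+(z/b)^a\}$: $\alpha=\theta=1$, $\tau\to0$, $\gamma=1/a$, $\beta=b\tau^{\gamma}$. 8. Weibull, $Z=bG_1^{a}$: $\alpha\to\infty$, $\theta=1$, $\tau\to0$, $\gamma=a$, $\beta=b\tau^{\gamma}$. 9. Fréchet, $\bar F(z)=1-e^{-(z/b)^{-a}}$: $\alpha=1$, $\theta\to\infty$, $\tau\to0$, $\gamma=1/a$, $\beta=b\tau^{\gamma}$. 10. Log-normal, $\log Z$ normal with mean $\xi$ and standard deviation $\sigma$: $\alpha\to\infty$ and $\theta\to\infty$ with $\theta/\alpha\to0$, $\tau=\sqrt{\theta}\,\sigma$, $\gamma=\theta\sigma^2$, $\beta=e^{-\sqrt{\theta}\,\sigma+\xi+1/2}$. -/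

import Mathlib

open MeasureTheory ProbabilityTheory Filter Topology

noncomputable section

/-- The law of `G_s`: the Gamma distribution with shape `s` and expectation `1` (rate `s`). -/
def unitGamma (s : ℝ) (hs : 0 < s) : ProbabilityMeasure ℝ :=
  ⟨gammaMeasure s s, isProbabilityMeasure_gammaMeasure hs hs⟩

/-- The law of `X = G_θ / G_α`, with `G_α` and `G_θ` independent: standard Burr(α, θ). -/
def standardBurr (α θ : ℝ) (hα : 0 < α) (hθ : 0 < θ) : ProbabilityMeasure ℝ :=
  ((unitGamma α hα).prod (unitGamma θ hθ)).map (f := fun g : ℝ × ℝ => g.2 / g.1)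
    (by fun_prop)

/-- Admissible parameter vectors `Φ = (α, θ, β, τ, γ)`. -/
structure PowerBurrParams where
  α : ℝ
  θ : ℝ
  β : ℝ
  τ : ℝ
  γ : ℝ
  α_pos : 0 < α
  θ_pos : 0 < θ
  β_pos : 0 < β
  τ_pos : 0 < τ
  γ_pos : 0 < γ

/-- The five-parameter PowerBurr distribution: the law of `Z = β {(1 + X / τ) ^ γ - 1}`
where `X` is standard Burr(α, θ). -/
def powerBurr5 (Φ : PowerBurrParams) : ProbabilityMeasure ℝ :=
  (standardBurr Φ.α Φ.θ Φ.α_pos Φ.θ_pos).map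
    (f := fun x : ℝ => Φ.β * ((1 + x / Φ.τ) ^ Φ.γ - 1)) (by fun_prop)

/-- `ν` has survival function `S` on the positive half-line. For a function `S` that tends to `1`
at `0` from the right, this determines `ν`, and `ν` is carried by `(0, ∞)`. -/
def HasSurvival (ν : ProbabilityMeasure ℝ) (S : ℝ → ℝ) : Prop :=
  ∀ z : ℝ, 0 < z → (ν : Measure ℝ).real (Set.Ioi z) = S z

/-- Burr: `Z = b G_c / G_a` with `G_a`, `G_c` independent. -/
def burrLaw (a b c : ℝ) (ha : 0 < a) (hc : 0 < c) : ProbabilityMeasure ℝ :=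
  ((unitGamma a ha).prod (unitGamma c hc)).map (f := fun g : ℝ × ℝ => b * g.2 / g.1)
    (by fun_prop)

/-- Pareto: survival function `1 / (1 + z / b) ^ a`. -/
def IsParetoLaw (a b : ℝ) (ν : ProbabilityMeasure ℝ) : Prop :=
  HasSurvival ν fun z => 1 / (1 + z / b) ^ a

/-- Gamma: `Z = b G_c`. -/
def gammaLaw (b c : ℝ) (hc : 0 < c) : ProbabilityMeasure ℝ :=
  (unitGamma c hc).map (f := fun g : ℝ => b * g) (by fun_prop)

/-- Inverse Gamma: `Z = b / G_a`. -/
def inverseGammaLaw (a b : ℝ) (ha : 0 < a) : ProbabilityMeasure ℝ :=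
  (unitGamma a ha).map (f := fun g : ℝ => b / g) (by fun_prop)

/-- Log-gamma: `log (1 + Z) = b G_c`. -/
def logGammaLaw (b c : ℝ) (hc : 0 < c) : ProbabilityMeasure ℝ :=
  (unitGamma c hc).map (f := fun g : ℝ => Real.exp (b * g) - 1) (by fun_prop)

/-- Logistic on the positive half-line: survival function `1 / (1 - a + a e ^ (z / b))`. -/
def IsLogisticLaw (a b : ℝ) (ν : ProbabilityMeasure ℝ) : Prop :=
  HasSurvival ν fun z => 1 / (1 - a + a * Real.exp (z / b))

/-- Log-logistic: survival function `1 / {1 + (z / b) ^ a}`. -/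
def IsLogLogisticLaw (a b : ℝ) (ν : ProbabilityMeasure ℝ) : Prop :=
  HasSurvival ν fun z => 1 / (1 + (z / b) ^ a)

/-- Weibull: `Z = b G_1 ^ a`. -/
def weibullLaw (a b : ℝ) : ProbabilityMeasure ℝ :=
  (unitGamma 1 one_pos).map (f := fun g : ℝ => b * g ^ a) (by fun_prop)

/-- Fréchet: survival function `1 - e ^ (-(z / b) ^ (-a))`. -/
def IsFrechetLaw (a b : ℝ) (ν : ProbabilityMeasure ℝ) : Prop :=
  HasSurvival ν fun z => 1 - Real.exp (-(z / b) ^ (-a))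

/-- Log-normal: `log Z` is normal with mean `ξ` and standard deviation `σ`. -/
def logNormalLaw (ξ σ : ℝ) : ProbabilityMeasure ℝ :=
  ProbabilityMeasure.map ⟨gaussianReal ξ (σ ^ 2).toNNReal, inferInstance⟩
    (f := Real.exp) (by fun_prop)

end

/-!
A PowerBurr variable is a deterministic transform of `X = G_θ / G_α`, so every limit is an instance
of the extended continuous mapping theorem `tendsto_map_of_ae_tendsto`: if `μs → μ` weakly and the
maps `f i` converge to `g` jointly in the index and the point, at `μ`-almost every point, then the
image laws converge. What remains is a limit law for the Gamma variables and a limit of real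
functions.

The probabilistic input is the central limit theorem for `√s (G_s - 1)` as the real shape `s` tends
to infinity, `tendsto_standardizedGamma`. The moment generating function of `G_s` is
`(1 - t / s) ^ (-s)`; the identity theorem continues it to the imaginary axis, and Lévy's theorem
applies to the resulting characteristic function. Consequently `G_s → 1` in law, which gives
`X → G_θ` as `α → ∞` and `X → 1 / G_α` as `θ → ∞`. In the log-normal case both standardized Gamma
variables are kept: as `θ / α → 0`, `√θ (X - 1)` is asymptotically the standardized `G_θ`, and the
power transform turns it into the exponential of a normal variable
(`tendsto_logNormal_transform`).

The Pareto, logistic and log-logistic survival functions come from the tail of `X` for `θ = 1`,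
`Pr(G_1 / G_a > x) = E[exp (-x G_a)] = (1 + x / a) ^ (-a)`, again the moment generating function of
a Gamma variable (`standardBurr_one_real_Ioi`). The Fréchet one is the distribution function of
`G_1`, read through `1 / G_1`.
-/

/-! ### The extended continuous mapping theorem -/

/-- The extended continuous mapping theorem: if `μs → μ` weakly and, for `μ`-almost every `x`,
`f i y → g x` jointly as `i → l` and `y → x`, then the image laws converge weakly. -/
theorem tendsto_map_of_ae_tendsto {ι X Y : Type*} [TopologicalSpace X]
    [SecondCountableTopology X] [TopologicalSpace.IsCompletelyPseudoMetrizableSpace X]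
    [MeasurableSpace X] [BorelSpace X]
    [TopologicalSpace Y] [TopologicalSpace.PseudoMetrizableSpace Y]
    [MeasurableSpace Y] [BorelSpace Y] {l : Filter ι} [l.IsCountablyGenerated]
    {μs : ι → ProbabilityMeasure X} {μ : ProbabilityMeasure X} (hμ : Tendsto μs l (𝓝 μ))
    {f : ι → X → Y} {g : X → Y} (hf : ∀ i, Measurable (f i)) (hg : Measurable g)
    (h : ∀ᵐ x ∂(μ : Measure X), Tendsto (fun p : ι × X => f p.1 p.2) (l ×ˢ 𝓝 x) (𝓝 (g x))) :
    Tendsto (fun i => (μs i).map (hf i).aemeasurable) l (𝓝 (μ.map hg.aemeasurable)) := by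
  refine tendsto_of_forall_isOpen_le_liminf' fun G hG => ?_
  obtain ⟨N, hDN, hNmeas, hN⟩ := exists_measurable_superset_of_null (mem_ae_iff.1 h)
  have hlimit : ∀ x ∉ N, Tendsto (fun p : ι × X => f p.1 p.2) (l ×ˢ 𝓝 x) (𝓝 (g x)) :=
    fun x hx => by_contra fun hx' => hx (hDN hx')
  simp only [ProbabilityMeasure.toMeasure_map, Measure.map_apply hg hG.measurableSet,
    Measure.map_apply (hf _) hG.measurableSet]
  refine le_of_forall_lt_imp_le_of_dense fun c hc => ?_
  rw [← measure_sdiff_null hN] at hc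
  -- Compactness of `K` makes the joint convergence uniform: one `S ∈ l` serves all of `K`.
  obtain ⟨K, hKsub, hK, hcK⟩ := ((hg hG.measurableSet).diff hNmeas).exists_lt_isCompact hc
  have hloc : ∀ x ∈ K, ∃ S ∈ l, ∃ U, IsOpen U ∧ x ∈ U ∧ ∀ i ∈ S, U ⊆ f i ⁻¹' G := by
    intro x hx
    have hev := hlimit x (hKsub hx).2 (hG.mem_nhds (hKsub hx).1)
    obtain ⟨S, hS, V, hV, hSV⟩ := mem_prod_iff.1 hev
    obtain ⟨U, hUV, hU, hxU⟩ := mem_nhds_iff.1 hV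
    exact ⟨S, hS, U, hU, hxU, fun i hi y hy => hSV (Set.mk_mem_prod hi (hUV hy))⟩
  choose! S hS U hU hxU hSU using hloc
  obtain ⟨t, htK, hKt⟩ := hK.elim_nhds_subcover U fun x hx => (hU x hx).mem_nhds (hxU x hx)
  calc c ≤ (μ : Measure X) K := hcK.le
    _ ≤ (μ : Measure X) (⋃ x ∈ t, U x) := measure_mono hKt
    _ ≤ l.liminf fun i => (μs i : Measure X) (⋃ x ∈ t, U x) :=
      ProbabilityMeasure.le_liminf_measure_open_of_tendsto hμ
        (isOpen_biUnion fun x hx => hU x (htK x hx))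
    _ ≤ l.liminf fun i => (μs i : Measure X) (f i ⁻¹' G) := by
      refine liminf_le_liminf ?_
      filter_upwards [(biInter_finset_mem t).2 fun x hx => hS x (htK x hx)] with i hi
      refine measure_mono (Set.iUnion₂_subset fun x hx => hSU x (htK x hx) i ?_)
      exact Set.mem_iInter₂.1 hi x hx

/-! ### Transforms of the Gamma law -/

theorem mgf_gammaMeasure {a r t : ℝ} (ha : 0 < a) (hr : 0 < r) (ht : t < r) :
    mgf id (gammaMeasure a r) t = (1 - t / r) ^ (-a) := by
  have hrt : 0 < r - t := sub_pos.2 ht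
  have hpdf : ∀ x, gammaPDF a r x < ⊤ := fun x => ENNReal.ofReal_lt_top
  have hmeas : Measurable (gammaPDF a r) := (measurable_gammaPDFReal a r).ennreal_ofReal
  rw [mgf, gammaMeasure, integral_withDensity_eq_integral_toReal_smul hmeas (ae_of_all _ hpdf)]
  have hsupp : ∀ x ∉ Set.Ici (0 : ℝ), (gammaPDF a r x).toReal • Real.exp (t * id x) = 0 := by
    intro x hx
    simp [gammaPDF_of_neg (not_le.1 hx)]
  rw [← setIntegral_eq_integral_of_forall_compl_eq_zero hsupp, integral_Ici_eq_integral_Ioi]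
  calc ∫ x in Set.Ioi 0, (gammaPDF a r x).toReal • Real.exp (t * id x)
      = ∫ x in Set.Ioi 0, r ^ a / Real.Gamma a * (x ^ (a - 1) * Real.exp (-((r - t) * x))) := by
        refine setIntegral_congr_fun measurableSet_Ioi fun x (hx : 0 < x) => ?_
        simp only [gammaPDF, smul_eq_mul, id_eq]
        rw [ENNReal.toReal_ofReal (gammaPDFReal_nonneg ha hr x), gammaPDFReal, if_pos hx.le, mul_assoc, mul_assoc, ← Real.exp_add]
        ring_nf
    _ = r ^ a / Real.Gamma a * ((1 / (r - t)) ^ a * Real.Gamma a) := by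
        rw [integral_const_mul, Real.integral_rpow_mul_exp_neg_mul_Ioi ha hrt]
    _ = (r * (1 / (r - t))) ^ a := by
        rw [Real.mul_rpow hr.le (by positivity)]
        field_simp [(Real.Gamma_pos_of_pos ha).ne']
    _ = (1 - t / r) ^ (-a) := by
        rw [Real.rpow_neg (by rw [sub_nonneg, div_le_one hr]; exact ht.le),
          ← Real.inv_rpow (by rw [sub_nonneg, div_le_one hr]; exact ht.le)]
        congr 1
        field_simp

/-- The moment generating function continued to the half-plane `re z < r` by the identity theorem.
The power is written through the principal logarithm, `1 - z / r` having positive real part. -/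
theorem complexMGF_gammaMeasure {a r : ℝ} (ha : 0 < a) (hr : 0 < r) {z : ℂ} (hz : z.re < r) :
    complexMGF id (gammaMeasure a r) z = Complex.exp (-a * Complex.log (1 - z / r)) := by
  have := isProbabilityMeasure_gammaMeasure ha hr
  have hset : Set.Iio r ⊆ interior (integrableExpSet id (gammaMeasure a r)) := by
    refine interior_maximal (fun t (ht : t < r) => ?_) isOpen_Iio
    refine mgf_pos_iff.1 ?_
    rw [mgf_gammaMeasure ha hr ht]
    exact Real.rpow_pos_of_pos (by rw [sub_pos, div_lt_one hr]; exact ht) _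
  have hslit : ∀ z : ℂ, z.re < r → 1 - z / r ∈ Complex.slitPlane := by
    intro z hz
    refine Or.inl ?_
    rw [Complex.sub_re, Complex.div_ofReal_re, Complex.one_re, sub_pos, div_lt_one hr]
    exact hz
  have hopen : IsOpen {z : ℂ | z.re < r} := isOpen_lt Complex.continuous_re continuous_const
  have hX : AnalyticOnNhd ℂ (complexMGF id (gammaMeasure a r)) {z | z.re < r} :=
    analyticOnNhd_complexMGF.mono fun z hz => hset hz
  have hY : AnalyticOnNhd ℂ (fun z : ℂ => Complex.exp (-a * Complex.log (1 - z / r)))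
      {z | z.re < r} := by
    refine DifferentiableOn.analyticOnNhd (fun z hz => ?_) hopen
    have := hslit z hz
    fun_prop (disch := assumption)
  refine AnalyticOnNhd.eqOn_of_preconnected_of_frequently_eq hX hY
    (convex_halfSpace_re_lt r).isPreconnected (z₀ := (0 : ℂ)) (by simpa using hr) ?_ hz
  have h_real : ∃ᶠ x : ℝ in 𝓝[≠] 0, complexMGF id (gammaMeasure a r) x =
      Complex.exp (-a * Complex.log (1 - x / r)) := by
    refine Eventually.frequently ?_
    filter_upwards [nhdsWithin_le_nhds (Iio_mem_nhds hr)] with x (hx : x < r)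
    have hpos : 0 < 1 - x / r := by rw [sub_pos, div_lt_one hr]; exact hx
    rw [complexMGF_ofReal, mgf_gammaMeasure ha hr hx, Real.rpow_def_of_pos hpos, mul_comm]
    push_cast [Complex.ofReal_log hpos.le]
    rfl
  have hcast : Tendsto (fun x : ℝ => (x : ℂ)) (𝓝[≠] 0) (𝓝[≠] 0) := by
    refine tendsto_nhdsWithin_iff.2 ⟨?_, ?_⟩
    · exact (Complex.continuous_ofReal.tendsto' 0 0 (by simp)).mono_left nhdsWithin_le_nhds
    · filter_upwards [self_mem_nhdsWithin] with x hx
      simpa using hx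
  exact hcast.frequently h_real

theorem charFun_unitGamma {s : ℝ} (hs : 0 < s) (t : ℝ) :
    charFun (unitGamma s hs : Measure ℝ) t =
      Complex.exp (-s * Complex.log (1 - t * Complex.I / s)) := by
  rw [← complexMGF_id_mul_I]
  exact complexMGF_gammaMeasure hs hs (by simpa using hs)

theorem unitGamma_ae_pos {s : ℝ} (hs : 0 < s) : ∀ᵐ g ∂(unitGamma s hs : Measure ℝ), 0 < g := by
  have hmeas : Measurable (gammaPDF s s) := (measurable_gammaPDFReal s s).ennreal_ofReal
  change ∀ᵐ g ∂(volume.withDensity (gammaPDF s s)), 0 < g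
  rw [ae_withDensity_iff hmeas]
  filter_upwards [Measure.ae_ne volume 0] with g hg0 hg
  by_contra hneg
  exact hg (gammaPDF_of_neg (lt_of_le_of_ne (not_lt.1 hneg) hg0))

/-! ### Limits of real and complex functions -/

/-- The second-order expansion of the logarithm, scaled: the error of
`log (1 + y) ≈ y - y ^ 2 / 2` is negligible against a factor `n` with `n * y ^ 2` convergent. -/
theorem tendsto_mul_log_one_add_sub {ι : Type*} {l : Filter ι} {n y : ι → ℂ} {c : ℂ}
    (hy : Tendsto y l (𝓝 0)) (hc : Tendsto (fun i => n i * y i ^ 2) l (𝓝 c)) :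
    Tendsto (fun i => n i * Complex.log (1 + y i) - n i * y i) l (𝓝 (-(c / 2))) := by
  have hbound : Tendsto (fun i => ‖n i * y i ^ 2‖ * (‖y i‖ * (1 - ‖y i‖)⁻¹ / 3)) l (𝓝 0) := by
    have h1 : Tendsto (fun i => ‖y i‖) l (𝓝 0) := by simpa using hy.norm
    have h2 : Tendsto (fun i => (1 - ‖y i‖)⁻¹) l (𝓝 1) := by
      simpa using (tendsto_const_nhds.sub h1).inv₀ (by norm_num : (1 : ℝ) - 0 ≠ 0)
    simpa using hc.norm.mul ((h1.mul h2).div_const 3)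
  have herr : Tendsto (fun i => n i * (Complex.log (1 + y i) - Complex.logTaylor 3 (y i))) l
      (𝓝 0) := by
    refine squeeze_zero_norm' ?_ hbound
    filter_upwards [hy.norm.eventually (gt_mem_nhds (by norm_num : ‖(0 : ℂ)‖ < 1))] with i hi
    have := Complex.norm_log_sub_logTaylor_le 2 hi
    calc ‖n i * (Complex.log (1 + y i) - Complex.logTaylor 3 (y i))‖
        ≤ ‖n i‖ * (‖y i‖ ^ 3 * (1 - ‖y i‖)⁻¹ / 3) := by
          rw [norm_mul]
          gcongr
          norm_num at this
          exact this
      _ = ‖n i * y i ^ 2‖ * (‖y i‖ * (1 - ‖y i‖)⁻¹ / 3) := by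
          rw [norm_mul, norm_pow]; ring
  have := herr.sub (hc.div_const 2)
  simp only [zero_sub] at this
  refine this.congr fun i => ?_
  simp [Complex.logTaylor_succ, Complex.logTaylor_zero]
  ring

theorem tendsto_mul_real_log_one_add_sub {ι : Type*} {l : Filter ι} {n y : ι → ℝ} {c : ℝ}
    (hy : Tendsto y l (𝓝 0)) (hc : Tendsto (fun i => n i * y i ^ 2) l (𝓝 c)) :
    Tendsto (fun i => n i * Real.log (1 + y i) - n i * y i) l (𝓝 (-(c / 2))) := by
  have hy' : Tendsto (fun i => (y i : ℂ)) l (𝓝 0) := by exact_mod_cast hy.ofReal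
  have hc' : Tendsto (fun i => (n i : ℂ) * (y i : ℂ) ^ 2) l (𝓝 (c : ℂ)) := by
    exact_mod_cast hc.ofReal
  have key := (Complex.continuous_re.tendsto _).comp (tendsto_mul_log_one_add_sub hy' hc')
  convert! key using 2 with i
  · simp only [Function.comp, Complex.sub_re, Complex.re_ofReal_mul, Complex.ofReal_re]
    rw [← Complex.ofReal_one, ← Complex.ofReal_add, Complex.log_ofReal_re]
  · rw [Complex.neg_re, ← Complex.ofReal_ofNat, Complex.div_ofReal_re, Complex.ofReal_re]

theorem tendsto_mul_log_one_add {ι : Type*} {l : Filter ι} {n y : ι → ℝ} {c : ℝ}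
    (hy : Tendsto y l (𝓝 0)) (hc : Tendsto (fun i => n i * y i) l (𝓝 c)) :
    Tendsto (fun i => n i * Real.log (1 + y i)) l (𝓝 c) := by
  have hcont : ContinuousAt (dslope Real.log 1) 1 :=
    continuousAt_dslope_same.2 (Real.differentiableAt_log one_ne_zero)
  have h1 : Tendsto (fun i => 1 + y i) l (𝓝 1) := by simpa using hy.const_add 1
  have h2 := hc.mul (hcont.tendsto.comp h1)
  rw [dslope_same, Real.deriv_log, inv_one, mul_one] at h2
  refine h2.congr fun i => ?_
  have := sub_smul_dslope Real.log 1 (1 + y i)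
  rw [Real.log_one, sub_zero, add_sub_cancel_left, smul_eq_mul] at this
  rw [← this, Function.comp, mul_assoc]

theorem tendsto_exp_mul_sub_one_div {ι : Type*} {l : Filter ι} {n y : ι → ℝ} {c : ℝ}
    (hn : ∀ i, n i ≠ 0) (hn0 : Tendsto n l (𝓝 0)) (hc : Tendsto y l (𝓝 c)) :
    Tendsto (fun i => (Real.exp (n i * y i) - 1) / n i) l (𝓝 c) := by
  have hcont : ContinuousAt (dslope Real.exp 0) 0 :=
    continuousAt_dslope_same.2 Real.differentiableAt_exp
  have h1 : Tendsto (fun i => n i * y i) l (𝓝 0) := by simpa using hn0.mul hc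
  have h2 := hc.mul (hcont.tendsto.comp h1)
  rw [dslope_same, Real.deriv_exp, Real.exp_zero, mul_one] at h2
  refine h2.congr fun i => ?_
  have := sub_smul_dslope Real.exp 0 (n i * y i)
  rw [Real.exp_zero, sub_zero, smul_eq_mul] at this
  rw [← this, Function.comp]
  field_simp [hn i]

/-- As the shape `n` and the scale `τ = n / b` grow together, the power transform becomes an
exponential. -/
theorem tendsto_one_add_div_rpow_exp {ι : Type*} {l : Filter ι} {n y : ι → ℝ} {b c : ℝ}
    (hb : 0 < b) (hn : Tendsto n l atTop) (hy : Tendsto y l (𝓝 c)) :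
    Tendsto (fun i => (1 + y i / (n i / b)) ^ n i) l (𝓝 (Real.exp (b * c))) := by
  have h0 : Tendsto (fun i => y i / (n i / b)) l (𝓝 0) := hy.div_atTop (hn.atTop_div_const hb)
  have h1 : Tendsto (fun i => n i * (y i / (n i / b))) l (𝓝 (b * c)) := by
    refine (hy.const_mul b).congr' ?_
    filter_upwards [hn.eventually_gt_atTop 0] with i hi
    field_simp
  refine ((Real.continuous_exp.tendsto _).comp (tendsto_mul_log_one_add h0 h1)).congr' ?_
  filter_upwards [h0.eventually (lt_mem_nhds (by norm_num : (-1 : ℝ) < 0))] with i hi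
  rw [Real.rpow_def_of_pos (by linarith), mul_comm, Function.comp, mul_comm]

/-- As the shape `n` vanishes, the power transform becomes a logarithm. -/
theorem tendsto_div_mul_rpow_sub_one {ι : Type*} {l : Filter ι} {n y : ι → ℝ} {a b c : ℝ}
    (ha : 0 < a) (hc0 : 0 < c) (hn : ∀ i, 0 < n i) (hn0 : Tendsto n l (𝓝 0))
    (hy : Tendsto y l (𝓝 c)) :
    Tendsto (fun i => b / n i * ((1 + y i / a) ^ n i - 1)) l
      (𝓝 (b * Real.log (1 + c / a))) := by
  have hpos : 0 < 1 + c / a := by positivity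
  have h1 : Tendsto (fun i => 1 + y i / a) l (𝓝 (1 + c / a)) := (hy.div_const a).const_add 1
  have h2 := (Real.continuousAt_log hpos.ne').tendsto.comp h1
  refine ((tendsto_exp_mul_sub_one_div (fun i => (hn i).ne') hn0 h2).const_mul b).congr' ?_
  filter_upwards [h1.eventually (lt_mem_nhds hpos)] with i hi
  rw [Real.rpow_def_of_pos hi, Function.comp, mul_comm (n i)]
  ring

/-- As the scale `τ` vanishes, the power transform becomes a pure power. -/
theorem tendsto_rpow_sub_rpow {ι : Type*} {l : Filter ι} {τ y : ι → ℝ} {b γ c : ℝ}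
    (hγ : 0 < γ) (hc : 0 < c) (hτ : ∀ i, 0 < τ i) (hτ0 : Tendsto τ l (𝓝 0))
    (hy : Tendsto y l (𝓝 c)) :
    Tendsto (fun i => b * τ i ^ γ * ((1 + y i / τ i) ^ γ - 1)) l (𝓝 (b * c ^ γ)) := by
  have h1 : Tendsto (fun i => (τ i + y i) ^ γ) l (𝓝 (c ^ γ)) := by
    simpa using (hτ0.add hy).rpow_const (Or.inr hγ.le)
  have h2 : Tendsto (fun i => τ i ^ γ) l (𝓝 0) := by
    simpa [Real.zero_rpow hγ.ne'] using hτ0.rpow_const (p := γ) (Or.inr hγ.le)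
  have h3 := (h1.sub h2).const_mul b
  rw [sub_zero] at h3
  refine h3.congr' ?_
  filter_upwards [hy.eventually (lt_mem_nhds hc)] with i hi
  have hτi := hτ i
  have : τ i + y i = τ i * (1 + y i / τ i) := by field_simp
  rw [this, Real.mul_rpow hτi.le (by positivity)]
  ring

/-- The deterministic limit behind the log-normal case, with `G_α = 1 + u / √α` and
`G_θ = 1 + v / √θ`. In `θσ² log (1 + X / (√θ σ)) = √θ σ X - X² / 2 + o(1)` the first term, once
recentred by `β`, leaves `σ √θ (X - 1) → σ v`, and the second cancels the `1 / 2` in `β`. -/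
theorem tendsto_logNormal_transform {ι : Type*} {l : Filter ι} {α θ u v : ι → ℝ}
    {ξ σ x y : ℝ} (hσ : 0 < σ) (hθ : ∀ i, 0 < θ i)
    (hα' : Tendsto α l atTop) (hθ' : Tendsto θ l atTop)
    (hθα : Tendsto (fun i => θ i / α i) l (𝓝 0))
    (hu : Tendsto u l (𝓝 x)) (hv : Tendsto v l (𝓝 y)) :
    Tendsto (fun i => Real.exp (-(√(θ i) * σ) + ξ + 1 / 2) *
      ((1 + (1 + v i / √(θ i)) / (1 + u i / √(α i)) / (√(θ i) * σ)) ^ (θ i * σ ^ 2) - 1)) l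
      (𝓝 (Real.exp (ξ + σ * y))) := by
  have hsα : Tendsto (fun i => √(α i)) l atTop := Real.tendsto_sqrt_atTop.comp hα'
  have hsθ : Tendsto (fun i => √(θ i)) l atTop := Real.tendsto_sqrt_atTop.comp hθ'
  have hscale : Tendsto (fun i => √(θ i) * σ) l atTop := hsθ.atTop_mul_const hσ
  have hden : Tendsto (fun i => 1 + u i / √(α i)) l (𝓝 1) := by
    simpa using (hu.div_atTop hsα).const_add 1
  set X : ι → ℝ := fun i => (1 + v i / √(θ i)) / (1 + u i / √(α i)) with hXdef
  have hX : Tendsto X l (𝓝 1) := by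
    have h := ((hv.div_atTop hsθ).const_add 1).div hden one_ne_zero
    rwa [add_zero, div_one] at h
  have hXcentred : Tendsto (fun i => √(θ i) * (X i - 1)) l (𝓝 y) := by
    have hratio : Tendsto (fun i => √(θ i / α i) * u i) l (𝓝 0) := by
      simpa using (hθα.sqrt).mul hu
    have := (hv.sub hratio).div hden one_ne_zero
    rw [sub_zero, div_one] at this
    refine this.congr' ?_
    filter_upwards [hden.eventually (lt_mem_nhds one_pos), hα'.eventually_gt_atTop 0] with i hi hαi
    have h1 : √(α i) ≠ 0 := (Real.sqrt_pos.2 hαi).ne'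
    have h2 : √(θ i) ≠ 0 := (Real.sqrt_pos.2 (hθ i)).ne'
    rw [Pi.div_apply, Real.sqrt_div (hθ i).le, div_eq_iff hi.ne']
    simp only [hXdef]
    rw [mul_assoc, sub_mul, div_mul_cancel₀ _ hi.ne']
    field_simp
    ring
  have hy0 : Tendsto (fun i => X i / (√(θ i) * σ)) l (𝓝 0) := hX.div_atTop hscale
  have hquad : Tendsto (fun i => θ i * σ ^ 2 * (X i / (√(θ i) * σ)) ^ 2) l (𝓝 1) := by
    have h := hX.pow 2
    rw [one_pow] at h
    refine h.congr fun i => ?_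
    have := hθ i
    rw [div_pow (X i), mul_pow, Real.sq_sqrt (hθ i).le]
    field_simp
  have hexp : Tendsto (fun i => -(√(θ i) * σ) + ξ + 1 / 2 +
      θ i * σ ^ 2 * Real.log (1 + X i / (√(θ i) * σ))) l (𝓝 (ξ + σ * y)) := by
    have h := ((tendsto_mul_real_log_one_add_sub hy0 hquad).add
      (hXcentred.const_mul σ)).add_const (ξ + 1 / 2)
    convert! h using 2 with i
    · have h2 : √(θ i) ≠ 0 := (Real.sqrt_pos.2 (hθ i)).ne'
      have h3 : θ i * σ ^ 2 * (X i / (√(θ i) * σ)) = √(θ i) * σ * X i := by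
        nth_rewrite 1 [← Real.mul_self_sqrt (hθ i).le]
        field_simp
      rw [h3]
      ring
    · ring
  have hβ : Tendsto (fun i => Real.exp (-(√(θ i) * σ) + ξ + 1 / 2)) l (𝓝 0) := by
    refine Real.tendsto_exp_atBot.comp ?_
    exact tendsto_atBot_add_const_right _ _ (tendsto_atBot_add_const_right _ _
      (tendsto_neg_atTop_atBot.comp hscale))
  have h := ((Real.continuous_exp.tendsto _).comp hexp).sub hβ
  rw [sub_zero] at h
  refine h.congr' ?_
  filter_upwards [hy0.eventually (lt_mem_nhds (by norm_num : (-1 : ℝ) < 0))] with i hi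
  rw [Function.comp, Real.exp_add, Real.rpow_def_of_pos (by linarith), mul_sub, mul_one,
    mul_comm (Real.log _)]

/-! ### The central limit theorem for the Gamma family -/

/-- The law of `√s (G_s - 1)`, the Gamma variable centred and scaled to unit variance. -/
noncomputable def standardizedGamma (s : ℝ) (hs : 0 < s) : ProbabilityMeasure ℝ :=
  (unitGamma s hs).map (f := fun g : ℝ => √s * (g - 1)) (by fun_prop)

/-- The exponent is displayed in the form `n log (1 + y) - n y` with `n = -s`, `y = -it / √s`, to
which the second-order expansion of the logarithm applies. -/
theorem charFun_standardizedGamma {s : ℝ} (hs : 0 < s) (t : ℝ) :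
    charFun (standardizedGamma s hs : Measure ℝ) t =
      Complex.exp (-s * Complex.log (1 + -(t * Complex.I / √s)) - -s * -(t * Complex.I / √s)) := by
  have hmap : (standardizedGamma s hs : Measure ℝ) =
      ((unitGamma s hs : Measure ℝ).map (√s * ·)).map (· + -√s) := by
    rw [Measure.map_map (by fun_prop) (by fun_prop)]
    change Measure.map _ _ = _
    congr 1
    ext g
    simp only [Function.comp]
    ring
  have hsq : ((√s : ℝ) : ℂ) ^ 2 = s := by
    rw [← Complex.ofReal_pow, Real.sq_sqrt hs.le]
  have h0 : ((√s : ℝ) : ℂ) ≠ 0 := by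
    exact_mod_cast (Real.sqrt_pos.2 hs).ne'
  rw [hmap, charFun_map_add_const, charFun_map_mul, charFun_unitGamma hs, ← Complex.exp_add]
  congr 1
  simp only [RCLike.inner_apply, conj_trivial]
  push_cast
  rw [← hsq]
  field_simp
  ring_nf

/-- The central limit theorem for the Gamma family with real shape `s → ∞`. -/
theorem tendsto_standardizedGamma {ι : Type*} {l : Filter ι} [l.IsCountablyGenerated]
    {s : ι → ℝ} (hs : ∀ i, 0 < s i) (hlim : Tendsto s l atTop) :
    Tendsto (fun i => standardizedGamma (s i) (hs i)) l
      (𝓝 ⟨gaussianReal 0 1, inferInstance⟩) := by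
  refine tendsto_of_seq_tendsto fun u hu => ?_
  refine ProbabilityMeasure.tendsto_of_tendsto_charFun fun t => ?_
  have hsu : Tendsto (fun n => √(s (u n))) atTop atTop :=
    Real.tendsto_sqrt_atTop.comp (hlim.comp hu)
  have hy : Tendsto (fun n => -(t * Complex.I / (√(s (u n)) : ℝ))) atTop (𝓝 (0 : ℂ)) := by
    have h1 : Tendsto (fun n => (((√(s (u n)))⁻¹ : ℝ) : ℂ)) atTop (𝓝 ((0 : ℝ) : ℂ)) :=
      (Complex.continuous_ofReal.tendsto 0).comp (tendsto_inv_atTop_zero.comp hsu)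
    have h2 := (h1.const_mul (t * Complex.I)).neg
    simp only [Complex.ofReal_zero, mul_zero, neg_zero] at h2
    refine h2.congr fun n => ?_
    push_cast
    rw [div_eq_mul_inv]
  have hc : Tendsto (fun n => -(s (u n) : ℂ) * (-(t * Complex.I / (√(s (u n)) : ℝ))) ^ 2) atTop
      (𝓝 ((t : ℂ) ^ 2)) := by
    refine tendsto_const_nhds.congr fun n => ?_
    have hsq : ((√(s (u n)) : ℝ) : ℂ) ^ 2 = s (u n) := by
      rw [← Complex.ofReal_pow, Real.sq_sqrt (hs _).le]
    have h0 : (s (u n) : ℂ) ≠ 0 := by exact_mod_cast (hs _).ne'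
    rw [neg_sq, div_pow, hsq, mul_pow, Complex.I_sq]
    field_simp
  have hmain := (Complex.continuous_exp.tendsto _).comp (tendsto_mul_log_one_add_sub hy hc)
  change Tendsto _ _ (𝓝 (charFun (gaussianReal 0 1) t))
  rw [charFun_gaussianReal]
  convert! hmain using 2
  · simp only [Function.comp]
    rw [charFun_standardizedGamma]
  · simp

/-- `G_s → 1` in law as `s → ∞`. -/
theorem tendsto_unitGamma {ι : Type*} {l : Filter ι} [l.IsCountablyGenerated]
    {s : ι → ℝ} (hs : ∀ i, 0 < s i) (hlim : Tendsto s l atTop) :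
    Tendsto (fun i => unitGamma (s i) (hs i)) l (𝓝 (diracProba 1)) := by
  have hsq : Tendsto (fun i => √(s i)) l atTop := Real.tendsto_sqrt_atTop.comp hlim
  have key := tendsto_map_of_ae_tendsto (tendsto_standardizedGamma hs hlim)
    (f := fun i w => 1 + w / √(s i)) (g := fun _ => (1 : ℝ)) (fun i => by fun_prop) (by fun_prop)
    (ae_of_all _ fun x => by
      have h1 : Tendsto (fun p : ι × ℝ => p.2) (l ×ˢ 𝓝 x) (𝓝 x) := tendsto_snd
      simpa using (h1.div_atTop (hsq.comp tendsto_fst)).const_add 1)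
  convert! key using 2 with i
  · refine Subtype.ext ?_
    change _ = Measure.map _ (Measure.map _ _)
    rw [Measure.map_map (by fun_prop) (by fun_prop)]
    refine Measure.map_id.symm.trans (congrArg (Measure.map · _) (funext fun g => ?_))
    have := (Real.sqrt_pos.2 (hs i)).ne'
    simp only [Function.comp, id]
    field_simp
    ring
  · refine Subtype.ext ?_
    change Measure.dirac 1 = Measure.map _ _
    rw [Measure.map_const]
    simp

/-! ### Limits of the standard Burr law -/

theorem standardBurr_ae_pos {α θ : ℝ} (hα : 0 < α) (hθ : 0 < θ) :
    ∀ᵐ x ∂(standardBurr α θ hα hθ : Measure ℝ), 0 < x := by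
  change ∀ᵐ x ∂(((unitGamma α hα : Measure ℝ).prod (unitGamma θ hθ : Measure ℝ)).map
    fun g : ℝ × ℝ => g.2 / g.1), 0 < x
  rw [ae_map_iff (by fun_prop) measurableSet_Ioi]
  filter_upwards [Measure.quasiMeasurePreserving_fst.ae (unitGamma_ae_pos hα),
    Measure.quasiMeasurePreserving_snd.ae (unitGamma_ae_pos hθ)] with g h1 h2
  exact div_pos h2 h1

/-- `G_c / G_α → G_c` in law as `α → ∞`. -/
theorem tendsto_standardBurr_of_left {ι : Type*} {l : Filter ι} [l.IsCountablyGenerated]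
    {α : ι → ℝ} {c : ℝ} (hα : ∀ i, 0 < α i) (hc : 0 < c) (hlim : Tendsto α l atTop) :
    Tendsto (fun i => standardBurr (α i) c (hα i) hc) l (𝓝 (unitGamma c hc)) := by
  have hprod : Tendsto (fun i => (unitGamma (α i) (hα i)).prod (unitGamma c hc)) l
      (𝓝 ((diracProba 1).prod (unitGamma c hc))) :=
    (ProbabilityMeasure.continuous_prod.tendsto (diracProba 1, unitGamma c hc)).comp
      ((tendsto_unitGamma hα hlim).prodMk_nhds tendsto_const_nhds)
  have hne : ∀ᵐ g ∂((diracProba (1 : ℝ)).prod (unitGamma c hc) : Measure (ℝ × ℝ)), g.1 ≠ 0 := by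
    change ∀ᵐ g ∂((Measure.dirac (1 : ℝ)).prod (unitGamma c hc : Measure ℝ)), g.1 ≠ 0
    refine Measure.quasiMeasurePreserving_fst.ae (p := fun x : ℝ => x ≠ 0) ?_
    exact (ae_dirac_iff (measurableSet_singleton (0 : ℝ)).compl).2 one_ne_zero
  have key := tendsto_map_of_ae_tendsto hprod (f := fun _ g => g.2 / g.1)
    (g := fun g => g.2 / g.1) (fun _ => by fun_prop) (by fun_prop) (by
      filter_upwards [hne] with g hg
      exact (continuousAt_snd.div continuousAt_fst hg).tendsto.comp tendsto_snd)
  convert! key using 2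
  refine Subtype.ext ?_
  change _ = Measure.map _ ((Measure.dirac 1).prod (unitGamma c hc : Measure ℝ))
  rw [Measure.dirac_prod, Measure.map_map (by fun_prop) (by fun_prop)]
  refine Measure.map_id.symm.trans (congrArg (Measure.map · _) (funext fun g => ?_))
  simp

/-- `G_θ / G_a → 1 / G_a` in law as `θ → ∞`. -/
theorem tendsto_standardBurr_of_right {ι : Type*} {l : Filter ι} [l.IsCountablyGenerated]
    {θ : ι → ℝ} {a : ℝ} (ha : 0 < a) (hθ : ∀ i, 0 < θ i) (hlim : Tendsto θ l atTop) :
    Tendsto (fun i => standardBurr a (θ i) ha (hθ i)) l (𝓝 (inverseGammaLaw a 1 ha)) := by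
  have hprod : Tendsto (fun i => (unitGamma a ha).prod (unitGamma (θ i) (hθ i))) l
      (𝓝 ((unitGamma a ha).prod (diracProba 1))) :=
    (ProbabilityMeasure.continuous_prod.tendsto (unitGamma a ha, diracProba 1)).comp
      (tendsto_const_nhds.prodMk_nhds (tendsto_unitGamma hθ hlim))
  have hne : ∀ᵐ g ∂((unitGamma a ha).prod (diracProba (1 : ℝ)) : Measure (ℝ × ℝ)), g.1 ≠ 0 := by
    refine Measure.quasiMeasurePreserving_fst.ae (p := fun x : ℝ => x ≠ 0) ?_
    filter_upwards [unitGamma_ae_pos ha] with x hx using hx.ne'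
  have key := tendsto_map_of_ae_tendsto hprod (f := fun _ g => g.2 / g.1)
    (g := fun g => g.2 / g.1) (fun _ => by fun_prop) (by fun_prop) (by
      filter_upwards [hne] with g hg
      exact (continuousAt_snd.div continuousAt_fst hg).tendsto.comp tendsto_snd)
  convert! key using 2
  refine Subtype.ext ?_
  change Measure.map _ _ = Measure.map _ ((unitGamma a ha : Measure ℝ).prod (Measure.dirac 1))
  rw [Measure.prod_dirac, Measure.map_map (by fun_prop) (by fun_prop)]
  rfl

/-- The reduction of every PowerBurr limit but the log-normal one to a limit law for `X` and a
joint limit of the power transforms. -/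
theorem tendsto_powerBurr5 {ι : Type*} {l : Filter ι} [l.IsCountablyGenerated]
    {Φ : ι → PowerBurrParams} {ν : ProbabilityMeasure ℝ} {g : ℝ → ℝ} (hg : Measurable g)
    (hν : Tendsto (fun i => standardBurr (Φ i).α (Φ i).θ (Φ i).α_pos (Φ i).θ_pos) l (𝓝 ν))
    (h : ∀ᵐ x ∂(ν : Measure ℝ),
      Tendsto (fun p : ι × ℝ => (Φ p.1).β * ((1 + p.2 / (Φ p.1).τ) ^ (Φ p.1).γ - 1))
        (l ×ˢ 𝓝 x) (𝓝 (g x))) :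
    Tendsto (fun i => powerBurr5 (Φ i)) l (𝓝 (ν.map hg.aemeasurable)) :=
  tendsto_map_of_ae_tendsto hν (fun i => by fun_prop) hg h

/-! ### Exact laws and survival functions -/

theorem unitGamma_one_real_Ioi {y : ℝ} (hy : 0 ≤ y) :
    (unitGamma 1 one_pos : Measure ℝ).real (Set.Ioi y) = Real.exp (-y) := by
  change (gammaMeasure 1 1).real (Set.Ioi y) = _
  have := isProbabilityMeasure_gammaMeasure one_pos one_pos
  have h := cdf_expMeasure_eq one_pos y
  rw [if_pos hy, expMeasure, cdf_eq_real, one_mul] at h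
  rw [← Set.compl_Iic, probReal_compl_eq_one_sub measurableSet_Iic, h]
  ring

theorem unitGamma_one_real_Iio {y : ℝ} (hy : 0 ≤ y) :
    (unitGamma 1 one_pos : Measure ℝ).real (Set.Iio y) = 1 - Real.exp (-y) := by
  have hatom : (unitGamma 1 one_pos : Measure ℝ) {y} = 0 :=
    withDensity_absolutelyContinuous volume (gammaPDF 1 1) (measure_singleton y)
  rw [← unitGamma_one_real_Ioi hy, ← probReal_compl_eq_one_sub measurableSet_Ioi, Set.compl_Ioi]
  exact measureReal_congr (Iio_ae_eq_Iic' hatom)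

/-- Conditioning on the denominator turns the tail of `G_1 / G_a` into the moment generating
function of `G_a` at `-x`. -/
theorem standardBurr_one_real_Ioi {a x : ℝ} (ha : 0 < a) (hx : 0 ≤ x) :
    (standardBurr a 1 ha one_pos : Measure ℝ).real (Set.Ioi x) = (1 + x / a) ^ (-a) := by
  have hset : (standardBurr a 1 ha one_pos : Measure ℝ) (Set.Ioi x) =
      ∫⁻ g, (unitGamma 1 one_pos : Measure ℝ) (Set.Ioi (x * g))
        ∂(unitGamma a ha : Measure ℝ) := by
    change Measure.map (fun g : ℝ × ℝ => g.2 / g.1)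
      ((unitGamma a ha : Measure ℝ).prod (unitGamma 1 one_pos : Measure ℝ)) _ = _
    rw [Measure.map_apply (by fun_prop) measurableSet_Ioi,
      Measure.prod_apply (measurableSet_Ioi.preimage (by fun_prop))]
    refine lintegral_congr_ae ?_
    filter_upwards [unitGamma_ae_pos ha] with g hg
    congr 1
    ext g'
    simp [lt_div_iff₀ hg]
  have hexp : ∫⁻ g, (unitGamma 1 one_pos : Measure ℝ) (Set.Ioi (x * g))
        ∂(unitGamma a ha : Measure ℝ) =
      ∫⁻ g, ENNReal.ofReal (Real.exp (-x * g)) ∂(unitGamma a ha : Measure ℝ) := by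
    refine lintegral_congr_ae ?_
    filter_upwards [unitGamma_ae_pos ha] with g hg
    rw [neg_mul, ← unitGamma_one_real_Ioi (mul_nonneg hx hg.le), ofReal_measureReal]
  rw [measureReal_def, hset, hexp, ← integral_eq_lintegral_of_nonneg_ae
    (ae_of_all _ fun g => (Real.exp_pos _).le) (by fun_prop)]
  have := mgf_gammaMeasure ha ha (t := -x) (by linarith)
  rw [neg_div, sub_neg_eq_add] at this
  exact this

theorem map_real_Ioi_of_ae_iff {ν : ProbabilityMeasure ℝ} {g : ℝ → ℝ} (hg : Measurable g)
    {y z : ℝ} (h : ∀ᵐ x ∂(ν : Measure ℝ), z < g x ↔ y < x) :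
    (ν.map hg.aemeasurable : Measure ℝ).real (Set.Ioi z) = (ν : Measure ℝ).real (Set.Ioi y) := by
  rw [ProbabilityMeasure.toMeasure_map, map_measureReal_apply hg measurableSet_Ioi]
  exact measureReal_congr (by filter_upwards [h] with x hx using propext hx)

theorem powerBurr5_eq_burrLaw {a b c : ℝ} (ha : 0 < a) (hb : 0 < b) (hc : 0 < c) :
    powerBurr5 ⟨a, c, b, 1, 1, ha, hc, hb, one_pos, one_pos⟩ = burrLaw a b c ha hc := by
  refine Subtype.ext ?_
  change Measure.map _ (Measure.map _ _) = Measure.map _ _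
  rw [Measure.map_map (by fun_prop) (by fun_prop)]
  refine congrArg (Measure.map · _) (funext fun g => ?_)
  simp [mul_div_assoc]

theorem isParetoLaw_powerBurr5 {a b : ℝ} (ha : 0 < a) (hb : 0 < b) :
    IsParetoLaw a b
      (powerBurr5 ⟨a, 1, b / a, 1, 1, ha, one_pos, div_pos hb ha, one_pos, one_pos⟩) := by
  intro z hz
  have hiff : ∀ x : ℝ, z < b / a * ((1 + x / 1) ^ (1 : ℝ) - 1) ↔ a * z / b < x := by
    intro x
    rw [Real.rpow_one, div_one, add_sub_cancel_left, div_lt_iff₀ hb, div_mul_eq_mul_div,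
      lt_div_iff₀ ha, mul_comm z, mul_comm b]
  have h := map_real_Ioi_of_ae_iff (by fun_prop)
    (ae_of_all (standardBurr a 1 ha one_pos : Measure ℝ) hiff)
  refine h.trans ((standardBurr_one_real_Ioi ha (by positivity)).trans ?_)
  beta_reduce
  rw [Real.rpow_neg (by positivity), one_div]
  congr 3
  field_simp

theorem isLogisticLaw_map {a b : ℝ} (ha : 0 < a) (hb : 0 < b) :
    IsLogisticLaw a b ((standardBurr 1 1 one_pos one_pos).map
      (f := fun x : ℝ => b * Real.log (1 + x / a)) (by fun_prop)) := by
  intro z hz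
  have h := map_real_Ioi_of_ae_iff (ν := standardBurr 1 1 one_pos one_pos)
    (g := fun x : ℝ => b * Real.log (1 + x / a)) (y := a * (Real.exp (z / b) - 1)) (z := z)
    (by fun_prop) (by
      filter_upwards [standardBurr_ae_pos one_pos one_pos] with x hx
      rw [← div_lt_iff₀' hb, Real.lt_log_iff_exp_lt (by positivity), ← lt_div_iff₀' ha,
        sub_lt_iff_lt_add'])
  have hpos : 0 ≤ Real.exp (z / b) - 1 := by
    rw [sub_nonneg, Real.one_le_exp_iff]
    positivity
  refine h.trans ((standardBurr_one_real_Ioi one_pos (by positivity)).trans ?_)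
  beta_reduce
  rw [Real.rpow_neg_one, one_div, div_one]
  congr 1
  ring

theorem lt_const_mul_rpow_one_div_iff {a b x z : ℝ} (ha : 0 < a) (hb : 0 < b) (hx : 0 < x)
    (hz : 0 < z) : z < b * x ^ (1 / a) ↔ (z / b) ^ a < x := by
  rw [← div_lt_iff₀' hb, one_div, Real.lt_rpow_inv_iff_of_pos (by positivity) hx.le ha]

theorem isLogLogisticLaw_map {a b : ℝ} (ha : 0 < a) (hb : 0 < b) :
    IsLogLogisticLaw a b ((standardBurr 1 1 one_pos one_pos).map
      (f := fun x : ℝ => b * x ^ (1 / a)) (by fun_prop)) := by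
  intro z hz
  have h := map_real_Ioi_of_ae_iff (ν := standardBurr 1 1 one_pos one_pos)
    (g := fun x : ℝ => b * x ^ (1 / a)) (by fun_prop) (by
      filter_upwards [standardBurr_ae_pos one_pos one_pos] with x hx
      exact lt_const_mul_rpow_one_div_iff ha hb hx hz)
  refine h.trans ((standardBurr_one_real_Ioi one_pos (by positivity)).trans ?_)
  beta_reduce
  rw [Real.rpow_neg_one, one_div, div_one]

theorem inverseGammaLaw_one_ae_pos {a : ℝ} (ha : 0 < a) :
    ∀ᵐ x ∂(inverseGammaLaw a 1 ha : Measure ℝ), 0 < x := by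
  change ∀ᵐ x ∂((unitGamma a ha : Measure ℝ).map fun g : ℝ => 1 / g), 0 < x
  rw [ae_map_iff (by fun_prop) measurableSet_Ioi]
  filter_upwards [unitGamma_ae_pos ha] with g hg
  exact one_div_pos.2 hg

theorem isFrechetLaw_map {a b : ℝ} (ha : 0 < a) (hb : 0 < b) :
    IsFrechetLaw a b ((inverseGammaLaw 1 1 one_pos).map
      (f := fun x : ℝ => b * x ^ (1 / a)) (by fun_prop)) := by
  intro z hz
  have h := map_real_Ioi_of_ae_iff (ν := inverseGammaLaw 1 1 one_pos)
    (g := fun x : ℝ => b * x ^ (1 / a)) (by fun_prop) (by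
      filter_upwards [inverseGammaLaw_one_ae_pos one_pos] with x hx
      exact lt_const_mul_rpow_one_div_iff ha hb hx hz)
  have hy : 0 < (z / b) ^ a := by positivity
  have hinv : (inverseGammaLaw 1 1 one_pos : Measure ℝ).real (Set.Ioi ((z / b) ^ a)) =
      (unitGamma 1 one_pos : Measure ℝ).real (Set.Iio ((z / b) ^ (-a))) := by
    change (Measure.map (fun g : ℝ => 1 / g) (unitGamma 1 one_pos : Measure ℝ)).real _ = _
    rw [map_measureReal_apply (by fun_prop) measurableSet_Ioi]
    refine measureReal_congr ?_
    filter_upwards [unitGamma_ae_pos one_pos] with g hg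
    refine propext ?_
    change (z / b) ^ a < 1 / g ↔ g < (z / b) ^ (-a)
    rw [Real.rpow_neg (by positivity), ← one_div, lt_one_div hy hg]
  exact h.trans (hinv.trans (unitGamma_one_real_Iio (by positivity)))

/-! ### The log-normal limit -/

theorem map_exp_gaussian_eq_logNormalLaw (ξ σ : ℝ) :
    (gaussianReal 0 1).map (fun w => Real.exp (ξ + σ * w)) = (logNormalLaw ξ σ : Measure ℝ) := by
  change _ = (gaussianReal ξ (σ ^ 2).toNNReal).map Real.exp
  have h1 : (fun w => Real.exp (ξ + σ * w)) = Real.exp ∘ (ξ + ·) ∘ (σ * ·) := rfl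
  rw [h1, ← Measure.map_map (by fun_prop) (by fun_prop),
    ← Measure.map_map (by fun_prop) (by fun_prop), gaussianReal_map_const_mul,
    gaussianReal_map_const_add]
  congr 2
  · ring
  · rw [mul_one]
    exact (Real.toNNReal_of_nonneg (sq_nonneg σ)).symm

/-- Here `√θ` magnifies the fluctuations of `X` about `1`, so the limit law of `X` alone does not
suffice; the mapping theorem is applied to the pair of standardized Gamma variables instead. -/
theorem tendsto_powerBurr5_logNormalLaw {ι : Type*} {l : Filter ι} [l.IsCountablyGenerated]
    {ξ σ : ℝ} (hσ : 0 < σ) {α θ : ι → ℝ} (hα : ∀ i, 0 < α i) (hθ : ∀ i, 0 < θ i)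
    (hαlim : Tendsto α l atTop) (hθlim : Tendsto θ l atTop)
    (hratio : Tendsto (fun i => θ i / α i) l (𝓝 0)) :
    Tendsto (fun i => powerBurr5
        ⟨α i, θ i, Real.exp (-(√(θ i) * σ) + ξ + 1 / 2), √(θ i) * σ, θ i * σ ^ 2,
          hα i, hθ i, Real.exp_pos _, mul_pos (Real.sqrt_pos.mpr (hθ i)) hσ,
          mul_pos (hθ i) (pow_pos hσ 2)⟩) l
      (𝓝 (logNormalLaw ξ σ)) := by
  have hprod := (ProbabilityMeasure.continuous_prod.tendsto _).comp
    ((tendsto_standardizedGamma hα hαlim).prodMk_nhds (tendsto_standardizedGamma hθ hθlim))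
  have key := tendsto_map_of_ae_tendsto hprod
    (f := fun i w => Real.exp (-(√(θ i) * σ) + ξ + 1 / 2) *
      ((1 + (1 + w.2 / √(θ i)) / (1 + w.1 / √(α i)) / (√(θ i) * σ)) ^ (θ i * σ ^ 2) - 1))
    (g := fun w => Real.exp (ξ + σ * w.2)) (fun i => by fun_prop) (by fun_prop)
    (ae_of_all _ fun x => tendsto_logNormal_transform hσ (fun p => hθ p.1)
      (hαlim.comp tendsto_fst) (hθlim.comp tendsto_fst) (hratio.comp tendsto_fst)
      ((continuous_fst.tendsto x).comp tendsto_snd) ((continuous_snd.tendsto x).comp tendsto_snd))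
  convert! key using 2 with i
  · refine Subtype.ext ?_
    change Measure.map _ (Measure.map _ _) = Measure.map _
      ((Measure.map _ (unitGamma (α i) (hα i) : Measure ℝ)).prod
        (Measure.map _ (unitGamma (θ i) (hθ i) : Measure ℝ)))
    rw [Measure.map_prod_map _ _ (by fun_prop) (by fun_prop),
      Measure.map_map (by fun_prop) (by fun_prop), Measure.map_map (by fun_prop) (by fun_prop)]
    refine congrArg (Measure.map · _) (funext fun g => ?_)
    have h1 : √(α i) ≠ 0 := (Real.sqrt_pos.2 (hα i)).ne'
    have h2 : √(θ i) ≠ 0 := (Real.sqrt_pos.2 (hθ i)).ne'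
    simp [mul_div_cancel_left₀, h1, h2]
  · refine Subtype.ext ?_
    change _ = Measure.map ((fun w : ℝ => Real.exp (ξ + σ * w)) ∘ Prod.snd)
      ((gaussianReal 0 1).prod (gaussianReal 0 1))
    rw [← Measure.map_map (by fun_prop) (by fun_prop), Measure.map_snd_prod, measure_univ,
      one_smul, map_exp_gaussian_eq_logNormalLaw]
    rfl

/-! ### The ten families -/

theorem proposition2 {ι : Type*} (l : Filter ι) (a b c ξ σ : ℝ)
    (ha : 0 < a) (hb : 0 < b) (hc : 0 < c) (hσ : 0 < σ) :
    -- Burr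
    (powerBurr5 ⟨a, c, b, 1, 1, ha, hc, hb, one_pos, one_pos⟩ = burrLaw a b c ha hc) ∧
    -- Pareto
    (IsParetoLaw a b
      (powerBurr5 ⟨a, 1, b / a, 1, 1, ha, one_pos, div_pos hb ha, one_pos, one_pos⟩)) ∧
    -- Gamma
    (∀ (α : ι → ℝ) (hα : ∀ i, 0 < α i), Tendsto α l atTop →
      Tendsto (fun i => powerBurr5 ⟨α i, c, b, 1, 1, hα i, hc, hb, one_pos, one_pos⟩) l
        (𝓝 (gammaLaw b c hc))) ∧
    -- inverse Gamma
    (∀ (θ : ι → ℝ) (hθ : ∀ i, 0 < θ i), Tendsto θ l atTop →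
      Tendsto (fun i => powerBurr5 ⟨a, θ i, b, 1, 1, ha, hθ i, hb, one_pos, one_pos⟩) l
        (𝓝 (inverseGammaLaw a b ha))) ∧
    -- log-gamma
    (∀ (α γ : ι → ℝ) (hα : ∀ i, 0 < α i) (hγ : ∀ i, 0 < γ i),
      Tendsto α l atTop → Tendsto γ l atTop →
      Tendsto (fun i => powerBurr5
          ⟨α i, c, 1, γ i / b, γ i, hα i, hc, one_pos, div_pos (hγ i) hb, hγ i⟩) l
        (𝓝 (logGammaLaw b c hc))) ∧
    -- logistic
    (∃ ν : ProbabilityMeasure ℝ, IsLogisticLaw a b ν ∧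
      ∀ (γ : ι → ℝ) (hγ : ∀ i, 0 < γ i), Tendsto γ l (𝓝 0) →
      Tendsto (fun i => powerBurr5
          ⟨1, 1, b / γ i, a, γ i, one_pos, one_pos, div_pos hb (hγ i), ha, hγ i⟩) l (𝓝 ν)) ∧
    -- log-logistic
    (∃ ν : ProbabilityMeasure ℝ, IsLogLogisticLaw a b ν ∧
      ∀ (τ : ι → ℝ) (hτ : ∀ i, 0 < τ i), Tendsto τ l (𝓝 0) →
      Tendsto (fun i => powerBurr5
          ⟨1, 1, b * τ i ^ (1 / a), τ i, 1 / a, one_pos, one_pos,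
            mul_pos hb (Real.rpow_pos_of_pos (hτ i) _), hτ i, one_div_pos.mpr ha⟩) l (𝓝 ν)) ∧
    -- Weibull
    (∀ (α τ : ι → ℝ) (hα : ∀ i, 0 < α i) (hτ : ∀ i, 0 < τ i),
      Tendsto α l atTop → Tendsto τ l (𝓝 0) →
      Tendsto (fun i => powerBurr5
          ⟨α i, 1, b * τ i ^ a, τ i, a, hα i, one_pos,
            mul_pos hb (Real.rpow_pos_of_pos (hτ i) _), hτ i, ha⟩) l
        (𝓝 (weibullLaw a b))) ∧
    -- Fréchet
    (∃ ν : ProbabilityMeasure ℝ, IsFrechetLaw a b ν ∧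
      ∀ (θ τ : ι → ℝ) (hθ : ∀ i, 0 < θ i) (hτ : ∀ i, 0 < τ i),
      Tendsto θ l atTop → Tendsto τ l (𝓝 0) →
      Tendsto (fun i => powerBurr5
          ⟨1, θ i, b * τ i ^ (1 / a), τ i, 1 / a, one_pos, hθ i,
            mul_pos hb (Real.rpow_pos_of_pos (hτ i) _), hτ i, one_div_pos.mpr ha⟩) l (𝓝 ν)) ∧
    -- log-normal
    (∀ (α θ : ι → ℝ) (hα : ∀ i, 0 < α i) (hθ : ∀ i, 0 < θ i),
      Tendsto α l atTop → Tendsto θ l atTop → Tendsto (fun i => θ i / α i) l (𝓝 0) →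
      Tendsto (fun i => powerBurr5
          ⟨α i, θ i, Real.exp (-(√(θ i) * σ) + ξ + 1 / 2), √(θ i) * σ, θ i * σ ^ 2,
            hα i, hθ i, Real.exp_pos _, mul_pos (Real.sqrt_pos.mpr (hθ i)) hσ,
            mul_pos (hθ i) (pow_pos hσ 2)⟩) l
        (𝓝 (logNormalLaw ξ σ))) := by
  -- Weak convergence is tested along countably generated filters, whereas `l` is arbitrary. Each
  -- convergence is therefore proved along the coarsest filter making the parameters converge, which
  -- is countably generated, and restricted to `l`.
  have hfst : ∀ {f : Filter ι} {x : ℝ}, Tendsto (fun p : ι × ℝ => p.2) (f ×ˢ 𝓝 x) (𝓝 x) := by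
    intro f x
    exact tendsto_snd
  refine ⟨?_, ?_, ?_, ?_, ?_, ?_, ?_, ?_, ?_, ?_⟩
  · exact powerBurr5_eq_burrLaw ha hb hc
  · exact isParetoLaw_powerBurr5 ha hb
  · intro α hα hlim
    refine Tendsto.mono_left (x := comap α atTop) ?_ (map_le_iff_le_comap.1 hlim)
    refine tendsto_powerBurr5 (by fun_prop)
      (tendsto_standardBurr_of_left hα hc tendsto_comap) (ae_of_all _ fun x => ?_)
    simpa using hfst.const_mul b
  · intro θ hθ hlim
    refine Tendsto.mono_left (x := comap θ atTop) ?_ (map_le_iff_le_comap.1 hlim)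
    have key := tendsto_powerBurr5
      (Φ := fun i => ⟨a, θ i, b, 1, 1, ha, hθ i, hb, one_pos, one_pos⟩)
      (g := fun x => b * x) (by fun_prop)
      (tendsto_standardBurr_of_right ha hθ tendsto_comap)
      (ae_of_all _ fun x => by simpa using hfst.const_mul b)
    convert! key using 2
    refine Subtype.ext ?_
    change _ = Measure.map _ (Measure.map _ _)
    rw [Measure.map_map (by fun_prop) (by fun_prop)]
    refine congrArg (Measure.map · _) (funext fun g => ?_)
    simp [div_eq_mul_inv]
  · intro α γ hα hγ hαlim hγlim
    refine Tendsto.mono_left (x := comap α atTop ⊓ comap γ atTop) ?_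
      (le_inf (map_le_iff_le_comap.1 hαlim) (map_le_iff_le_comap.1 hγlim))
    refine tendsto_powerBurr5 (by fun_prop)
      (tendsto_standardBurr_of_left hα hc (tendsto_comap.mono_left inf_le_left))
      (ae_of_all _ fun x => ?_)
    have hγ' : Tendsto γ (comap α atTop ⊓ comap γ atTop) atTop :=
      tendsto_comap.mono_left inf_le_right
    simpa using (tendsto_one_add_div_rpow_exp hb (hγ'.comp tendsto_fst) hfst).sub_const 1
  · have hmeas : Measurable fun x : ℝ => b * Real.log (1 + x / a) := by fun_prop
    refine ⟨(standardBurr 1 1 one_pos one_pos).map hmeas.aemeasurable,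
      isLogisticLaw_map ha hb, fun γ hγ hlim => ?_⟩
    refine Tendsto.mono_left (x := comap γ (𝓝 0)) ?_ (map_le_iff_le_comap.1 hlim)
    refine tendsto_powerBurr5 hmeas tendsto_const_nhds ?_
    filter_upwards [standardBurr_ae_pos one_pos one_pos] with x hx
    exact tendsto_div_mul_rpow_sub_one ha hx (fun p => hγ p.1)
      (tendsto_comap.comp tendsto_fst) hfst
  · have hmeas : Measurable fun x : ℝ => b * x ^ (1 / a) := by fun_prop
    refine ⟨(standardBurr 1 1 one_pos one_pos).map hmeas.aemeasurable,
      isLogLogisticLaw_map ha hb, fun τ hτ hlim => ?_⟩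
    refine Tendsto.mono_left (x := comap τ (𝓝 0)) ?_ (map_le_iff_le_comap.1 hlim)
    refine tendsto_powerBurr5 hmeas tendsto_const_nhds ?_
    filter_upwards [standardBurr_ae_pos one_pos one_pos] with x hx
    exact tendsto_rpow_sub_rpow (one_div_pos.2 ha) hx (fun p => hτ p.1)
      (tendsto_comap.comp tendsto_fst) hfst
  · intro α τ hα hτ hαlim hτlim
    refine Tendsto.mono_left (x := comap α atTop ⊓ comap τ (𝓝 0)) ?_
      (le_inf (map_le_iff_le_comap.1 hαlim) (map_le_iff_le_comap.1 hτlim))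
    refine tendsto_powerBurr5 (by fun_prop)
      (tendsto_standardBurr_of_left hα one_pos (tendsto_comap.mono_left inf_le_left)) ?_
    filter_upwards [unitGamma_ae_pos one_pos] with x hx
    have hτ0 : Tendsto τ (comap α atTop ⊓ comap τ (𝓝 0)) (𝓝 0) :=
      tendsto_comap.mono_left inf_le_right
    exact tendsto_rpow_sub_rpow ha hx (fun p => hτ p.1) (hτ0.comp tendsto_fst) hfst
  · have hmeas : Measurable fun x : ℝ => b * x ^ (1 / a) := by fun_prop
    refine ⟨(inverseGammaLaw 1 1 one_pos).map hmeas.aemeasurable,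
      isFrechetLaw_map ha hb, fun θ τ hθ hτ hθlim hτlim => ?_⟩
    refine Tendsto.mono_left (x := comap θ atTop ⊓ comap τ (𝓝 0)) ?_
      (le_inf (map_le_iff_le_comap.1 hθlim) (map_le_iff_le_comap.1 hτlim))
    refine tendsto_powerBurr5 hmeas
      (tendsto_standardBurr_of_right one_pos hθ (tendsto_comap.mono_left inf_le_left)) ?_
    filter_upwards [inverseGammaLaw_one_ae_pos one_pos] with x hx
    have hτ0 : Tendsto τ (comap θ atTop ⊓ comap τ (𝓝 0)) (𝓝 0) :=
      tendsto_comap.mono_left inf_le_right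
    exact tendsto_rpow_sub_rpow (one_div_pos.2 ha) hx (fun p => hτ p.1)
      (hτ0.comp tendsto_fst) hfst
  · intro α θ hα hθ hαlim hθlim hratio
    refine Tendsto.mono_left
      (x := comap α atTop ⊓ comap θ atTop ⊓ comap (fun i => θ i / α i) (𝓝 0)) ?_
      (le_inf (le_inf (map_le_iff_le_comap.1 hαlim) (map_le_iff_le_comap.1 hθlim))
        (map_le_iff_le_comap.1 hratio))
    exact tendsto_powerBurr5_logNormalLaw hσ hα hθ
      (tendsto_comap.mono_left (inf_le_left.trans inf_le_left))
      (tendsto_comap.mono_left (inf_le_left.trans inf_le_right))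
      (tendsto_comap.mono_left inf_le_right)
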